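/- A Fréchet space is a complete metrizable locally convex topological vector space over $\mathbb C$. Let $E, F$ be Fréchet spaces and let $D \subset E$ be a domain, i.e. a non-empty connected open set. A map $f : D \to F$ is called holomorphic if it is continuous and, for all $a \in D$, $b \in E$ and every continuous linear functional $\varphi \in F'$, the function $t \mapsto \varphi(f(a + t b))$ is holomorphic on the open set $\{t \in \mathbb C : a + t b \in D\}$. Let $(f_i)_{i \in \mathbb N}$ be a sequence of holomorphic maps $f_i : D \to F$ which is locally bounded: every $a \in D$ has a neighbourhood $U \subset D$ such that $\bigcup_{i \in \mathbb N} f_i(U)$ is a bounded subset of $F$. Then the following assertions are equivalent: (i) There is a holomorphic map $f : D \to F$ such that $(f_i)_{i \in \mathbb N}$ converges to $f$ uniformly on every compact subset of $D$. (ii) The set $D_0 = \{z \in D : \lim_{i \to \infty} f_i(z) \text{ exists in } F\}$ is not rare (i.e. not nowhere dense) in $D$; that is, the closure of $D_0$ relative to $D$ has non-empty interior. -/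

import Mathlib

open Filter Topology

/-- A Fréchet space: a complete, metrizable (that is, Hausdorff with a countably generated
uniformity), locally convex topological vector space over `ℂ`. -/
class FrechetSpace (E : Type*) [AddCommGroup E] [Module ℂ E] [UniformSpace E] : Prop extends
    IsUniformAddGroup E, ContinuousSMul ℂ E, LocallyConvexSpace ℝ E, T2Space E,
    CompleteSpace E, IsCountablyGenerated (uniformity E)

section

variable {E F : Type*} [AddCommGroup E] [Module ℂ E] [UniformSpace E]
  [AddCommGroup F] [Module ℂ F] [UniformSpace F]

/-- `f` is Gâteaux holomorphic on `D`: for all `a ∈ D`, `b ∈ E` and every continuous linear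
functional `φ` on `F`, the function `t ↦ φ (f (a + t b))` of one complex variable is holomorphic on
the set of `t` with `a + t b ∈ D`. -/
def GateauxHolomorphicOn (f : E → F) (D : Set E) : Prop :=
  ∀ a ∈ D, ∀ b : E, ∀ φ : F →L[ℂ] ℂ,
    DifferentiableOn ℂ (fun t : ℂ => φ (f (a + t • b))) {t : ℂ | a + t • b ∈ D}

/-- `f` is holomorphic on the (open) set `D`: continuous and Gâteaux holomorphic. Only the values of
`f` on `D` matter. -/
def HolomorphicOn (f : E → F) (D : Set E) : Prop :=
  ContinuousOn f D ∧ GateauxHolomorphicOn f D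

/-- The sequence `f` is locally bounded on `D`: every point of `D` has a neighbourhood on which the
values (in `D`) of all members of the sequence lie in one bounded subset of `F`. -/
def LocallyBoundedSeqOn (f : ℕ → E → F) (D : Set E) : Prop :=
  ∀ a ∈ D, ∃ U ∈ 𝓝 a, Bornology.IsVonNBounded ℂ (⋃ i, f i '' (U ∩ D))

end

/-! By the Schwarz lemma along complex lines, a locally bounded sequence of holomorphic maps is
equicontinuous at every point of `D`. Equicontinuity makes pointwise convergence uniform on compact
sets, keeps limits holomorphic, and carries the Cauchy property from `D_0` to its closure, hence to
a non-empty open set. A one-variable Vitali estimate on lines then shows that the interior of the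
convergence set is relatively closed in `D`, so connectedness makes it all of `D`; completeness of
`F` supplies the limit. -/

/-- A quantitative form of Vitali's theorem in one variable: a bounded holomorphic function on the
disc of radius `2` that is small near `0` is small at `1`. -/
theorem exists_norm_apply_one_le {C ε δ : ℝ} (hC : 0 < C) (hε : 0 < ε) (hδ : 0 < δ) (hδ2 : δ < 2) :
    ∃ η > 0, ∀ h : ℂ → ℂ, DifferentiableOn ℂ h (Metric.ball 0 2) →
      (∀ t ∈ Metric.ball (0 : ℂ) 2, ‖h t‖ ≤ C) → (∀ t ∈ Metric.closedBall (0 : ℂ) δ, ‖h t‖ ≤ η) →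
      ‖h 1‖ ≤ ε := by
  -- Split the Taylor series of `h` at 1: Cauchy's estimate on radius 3/2 controls the tail from `N`
  -- on (3 is the sum of the powers of 2/3), and on radius `δ` the first `N` terms.
  obtain ⟨N, hN⟩ : ∃ N : ℕ, 3 * C * (2 / 3 : ℝ) ^ N ≤ ε / 2 := by
    obtain ⟨N, hN⟩ := exists_pow_lt_of_lt_one (show 0 < ε / 2 / (3 * C) by positivity)
      (show (2 / 3 : ℝ) < 1 by norm_num)
    refine ⟨N, ?_⟩
    rw [lt_div_iff₀ (by positivity)] at hN
    linarith
  set A : ℝ := ∑ n ∈ Finset.range N, (1 / δ ^ n) with hA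
  have hA0 : 0 ≤ A := Finset.sum_nonneg fun n _ => by positivity
  refine ⟨ε / 2 / (A + 1), by positivity, fun h hd hb hs => ?_⟩
  have cauchy : ∀ r M : ℝ, 0 < r → r < 2 → (∀ t ∈ Metric.closedBall (0 : ℂ) r, ‖h t‖ ≤ M) →
      ∀ n : ℕ, ‖((n.factorial : ℂ)⁻¹ • ((1 : ℂ) - 0) ^ n • iteratedDeriv n h 0)‖ ≤ M / r ^ n := by
    intro r M hr hr2 hM n
    have := Complex.norm_iteratedDeriv_le_of_forall_mem_sphere_norm_le (f := h) (c := 0) (C := M) n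
      hr ((hd.mono (Metric.closedBall_subset_ball hr2)).diffContOnCl_ball subset_rfl)
      fun z hz => hM z (Metric.sphere_subset_closedBall hz)
    have hf : (0 : ℝ) < n.factorial := by exact_mod_cast n.factorial_pos
    simp only [sub_zero, one_pow, one_smul, norm_smul, norm_inv, Complex.norm_natCast]
    rw [inv_mul_le_iff₀ hf]
    calc _ ≤ _ := this
      _ = _ := by ring
  have hsum := Complex.hasSum_taylorSeries_on_ball hd (z := 1) (by simp)
  set a : ℕ → ℂ := fun n => (n.factorial : ℂ)⁻¹ • ((1 : ℂ) - 0) ^ n • iteratedDeriv n h 0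
  have h1 : ∀ n, ‖a n‖ ≤ C * (2 / 3) ^ n := fun n => by
    refine (cauchy (3 / 2) C (by norm_num) (by norm_num)
      (fun t ht => hb t (Metric.closedBall_subset_ball (by norm_num) ht)) n).trans_eq ?_
    rw [div_eq_mul_inv, ← inv_pow]; norm_num
  have h2 : ∀ n, ‖a n‖ ≤ ε / 2 / (A + 1) * (1 / δ ^ n) := fun n => by
    refine (cauchy δ _ hδ hδ2 hs n).trans_eq ?_
    rw [mul_one_div]
  have hgeo : HasSum (fun n : ℕ => C * (2 / 3 : ℝ) ^ (n + N)) (3 * C * (2 / 3) ^ N) := by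
    have := (hasSum_geometric_of_lt_one (show (0 : ℝ) ≤ 2 / 3 by norm_num)
      (by norm_num)).mul_left (C * (2 / 3) ^ N)
    convert! this using 1
    · ext n; ring
    · norm_num; ring
  rw [← hsum.tsum_eq, ← hsum.summable.sum_add_tsum_nat_add N]
  have t1 : ‖∑ n ∈ Finset.range N, a n‖ ≤ ε / 2 := by
    refine (norm_sum_le_of_le _ fun n _ => h2 n).trans ?_
    rw [← Finset.mul_sum, ← hA, div_mul_eq_mul_div, div_le_iff₀ (by positivity)]
    nlinarith
  have t2 : ‖∑' n, a (n + N)‖ ≤ 3 * C * (2 / 3) ^ N :=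
    tsum_of_norm_bounded hgeo fun n => h1 (n + N)
  calc _ ≤ _ := norm_add_le _ _
    _ ≤ ε := by linarith

/-! ### Seminorms and functionals on a Fréchet space. -/

section

variable {E F : Type*} [AddCommGroup E] [Module ℂ E] [UniformSpace E]
  [AddCommGroup F] [Module ℂ F] [UniformSpace F]

theorem FrechetSpace.polynormableSpace [FrechetSpace F] : PolynormableSpace ℂ F := by
  have : ContinuousSMul ℝ F := IsScalarTower.continuousSMul ℂ
  open scoped ComplexOrder in
  have : LocallyConvexSpace ℂ F := by
    refine ⟨fun x => (LocallyConvexSpace.convex_basis (𝕜 := ℝ) x).to_hasBasis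
      (fun s hs => ⟨s, ⟨hs.1, ?_⟩, subset_rfl⟩) fun s hs => ⟨s, ⟨hs.1, ?_⟩, subset_rfl⟩⟩
    · exact convex_of_nonneg_surjective_algebraMap _
        (fun _ hy => RCLike.nonneg_iff_exists_ofReal.mp hy) hs.2
    · exact hs.2.lift ℝ
  exact LocallyConvexSpace.toPolynormableSpace

/-- Hahn–Banach from the line spanned by `v`; it reduces estimates in `F` to scalar ones. -/
theorem Seminorm.exists_dual_apply_eq [PolynormableSpace ℂ F] {q : Seminorm ℂ F}
    (hq : Continuous q) (v : F) : ∃ φ : F →L[ℂ] ℂ, ‖φ v‖ = q v ∧ ∀ x, ‖φ x‖ ≤ q x := by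
  by_cases hv : v = 0
  · exact ⟨0, by simp [hv], fun x => by simp⟩
  let e := LinearEquiv.toSpanNonzeroSingleton ℂ F v hv
  let l : Module.Dual ℂ (Submodule.span ℂ {v}) := (q v : ℂ) • e.symm.toLinearMap
  have hl : ∀ c : ℂ, l (e c) = q v * c := fun c => by simp [l]
  obtain ⟨φ, hφ, hle⟩ := Module.Dual.exists_continuous_extension_of_le_seminorm _ l hq (by
    intro x
    obtain ⟨c, rfl⟩ := e.surjective x
    rw [hl]
    simp [e, map_smul_eq_mul, abs_of_nonneg (apply_nonneg q v), mul_comm])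
  refine ⟨φ, ?_, hle⟩
  have h1 := hφ (e 1)
  rw [hl] at h1
  simp only [e, LinearEquiv.toSpanNonzeroSingleton_apply, one_smul, mul_one] at h1
  rw [h1]
  simp

theorem exists_seminorm_sub_lt_one_imp [PolynormableSpace ℂ F] [IsUniformAddGroup F]
    {W : Set (F × F)} (hW : W ∈ uniformity F) :
    ∃ q : Seminorm ℂ F, Continuous q ∧ ∀ x y, q (y - x) < 1 → (x, y) ∈ W := by
  rw [uniformity_eq_comap_nhds_zero F] at hW
  obtain ⟨V, hV, hVW⟩ := hW
  have hp := PolynormableSpace.withSeminorms ℂ F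
  obtain ⟨s, r, hr, hs⟩ := (hp.mem_nhds_iff 0 V).1 hV
  refine ⟨Real.toNNReal r⁻¹ • s.sup fun p : {p : Seminorm ℂ F // Continuous p} => p.1, ?_, ?_⟩
  · have hc : Continuous
        ((s.sup fun p : {p : Seminorm ℂ F // Continuous p} => p.1 : Seminorm ℂ F) : F → ℝ) :=
      Seminorm.continuous_finsetSup fun i _ => i.2
    exact hc.const_smul (Real.toNNReal r⁻¹)
  · intro x y hxy
    refine hVW (hs ?_)
    rw [Seminorm.mem_ball_zero]
    rwa [smul_apply, NNReal.smul_def, Real.coe_toNNReal _ (by positivity), smul_eq_mul,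
      inv_mul_lt_iff₀ hr, mul_one] at hxy

theorem Bornology.IsVonNBounded.exists_seminorm_le [PolynormableSpace ℂ F] {B : Set F}
    (hB : Bornology.IsVonNBounded ℂ B) {q : Seminorm ℂ F} (hq : Continuous q) :
    ∃ C > 0, ∀ x ∈ B, q x ≤ C := by
  obtain ⟨C, hC, h⟩ := (PolynormableSpace.withSeminorms ℂ F).isVonNBounded_iff_seminorm_bounded.1
    hB ⟨q, hq⟩
  exact ⟨C, hC, fun x hx => (h x hx).le⟩

end

/-- On compact sets, a pointwise convergent sequence which is equicontinuous at every point
converges uniformly. -/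
theorem tendstoUniformlyOn_of_equicontinuousAt {X α : Type*} [TopologicalSpace X] [UniformSpace α]
    {f : ℕ → X → α} {g : X → α} {K : Set X} (hK : IsCompact K)
    (he : ∀ x ∈ K, EquicontinuousAt f x) (hg : ∀ x ∈ K, Tendsto (fun i => f i x) atTop (𝓝 (g x))) :
    TendstoUniformlyOn f g atTop K := by
  have h := (EquicontinuousOn.tendsto_uniformOnFun_iff_pi' (𝔖 := {K}) (F := f) (by simpa using hK)
    (fun L hL x hx => by
      rw [Set.mem_singleton_iff.1 hL] at hx ⊢
      exact (he x hx).equicontinuousWithinAt K) atTop g).2 (by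
    rw [tendsto_pi_nhds]
    rintro ⟨x, hx⟩
    exact hg x (by simpa using hx))
  exact (UniformOnFun.tendsto_iff_tendstoUniformlyOn.1 h) K rfl

/-! ### Equicontinuity and propagation of convergence. -/

section

variable {E F : Type*} [AddCommGroup E] [Module ℂ E] [UniformSpace E]
  [AddCommGroup F] [Module ℂ F] [UniformSpace F]

theorem exists_balanced_add_mem [ContinuousAdd E] [ContinuousSMul ℂ E] {a : E} {U : Set E}
    (hU : U ∈ 𝓝 a) :
    ∃ V ∈ 𝓝 (0 : E), Balanced ℂ V ∧ ∀ v ∈ V, ∀ w ∈ V, a + v + w ∈ U := by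
  have hc : Tendsto (fun p : E × E => a + p.1 + p.2) (𝓝 0 ×ˢ 𝓝 0) (𝓝 a) := by
    rw [← nhds_prod_eq]
    refine Continuous.tendsto' (by fun_prop) _ _ (by simp)
  obtain ⟨V, ⟨hV, hVb⟩, hVU⟩ := (((nhds_basis_balanced ℂ E).prod_self).mem_iff).1 (hc hU)
  exact ⟨V, hV, hVb, fun v hv w hw => hVU (Set.mk_mem_prod hv hw)⟩

theorem LocallyBoundedSeqOn.equicontinuousAt [FrechetSpace E] [FrechetSpace F] {D : Set E}
    (hDo : IsOpen D) {f : ℕ → E → F} (hf : ∀ i, HolomorphicOn (f i) D)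
    (hb : LocallyBoundedSeqOn f D) {a : E} (ha : a ∈ D) : EquicontinuousAt f a := by
  have := FrechetSpace.polynormableSpace (F := F)
  obtain ⟨U, hU, hUb⟩ := hb a ha
  intro W hW
  obtain ⟨q, hq, hqW⟩ := exists_seminorm_sub_lt_one_imp hW
  obtain ⟨C, hC, hqC⟩ := hUb.exists_seminorm_le hq
  obtain ⟨V, hV, hVb, hVU⟩ := exists_balanced_add_mem (inter_mem hU (hDo.mem_nhds ha))
  -- Schwarz on the unit disc, where values differ by at most `2 * C`, gives `2 * C * r` at distance
  -- `r`; this must be below 1.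
  set r : ℝ := 1 / (2 * C + 1) with hr
  have hr0 : 0 < r := by positivity
  have hr1 : r < 1 := by rw [hr, div_lt_one (by positivity)]; linarith
  have hrC : 2 * C * r < 1 := by rw [hr, mul_one_div, div_lt_one (by positivity)]; linarith
  have hcont : Tendsto (fun x : E => ((r : ℂ)⁻¹) • (x - a)) (𝓝 a) (𝓝 0) :=
    Continuous.tendsto' (by fun_prop) _ _ (by simp)
  filter_upwards [hcont hV] with x hx i
  apply hqW
  set h : E := (r : ℂ)⁻¹ • (x - a) with hh
  have hx' : x = a + (r : ℂ) • h := by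
    rw [hh, smul_inv_smul₀ (by exact_mod_cast hr0.ne')]; abel
  have hmem : ∀ t ∈ Metric.ball (0 : ℂ) 1, a + t • h ∈ U ∩ D := fun t ht => by
    have := hVU _ (hVb.smul_mem (mem_ball_zero_iff.1 ht).le hx) 0 (mem_of_mem_nhds hV)
    simpa using this
  have hbd : ∀ y ∈ U ∩ D, q (f i y) ≤ C := fun y hy =>
    hqC _ (Set.mem_iUnion.2 ⟨i, Set.mem_image_of_mem _ hy⟩)
  obtain ⟨φ, hφ, hφq⟩ := q.exists_dual_apply_eq hq (f i x - f i a)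
  have hs := Complex.dist_le_div_mul_dist_of_mapsTo_ball (c := 0) (R₁ := 1) (R₂ := 2 * C)
    (z := (r : ℂ)) (((hf i).2 a ha h φ).mono fun t ht => (hmem t ht).2) (by
      intro t ht
      rw [Metric.mem_closedBall, dist_eq_norm, ← map_sub]
      refine (hφq _).trans ((map_sub_le_add q _ _).trans ?_)
      have h1 := hbd _ (hmem t ht)
      have h2 := hbd _ (hmem 0 (by simp))
      linarith) (by simpa [abs_of_pos hr0] using hr1)
  simp only [zero_smul, add_zero, ← hx', dist_eq_norm, ← map_sub, hφ, sub_zero, div_one,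
    Complex.norm_real, Real.norm_eq_abs, abs_of_pos hr0] at hs
  linarith

/-- Along a complex line, convergence near the centre of a disc on which the sequence is bounded
propagates. -/
theorem cauchySeq_apply_add_of_line [FrechetSpace F] [FrechetSpace E] {D : Set E}
    {f : ℕ → E → F} (hf : ∀ i, HolomorphicOn (f i) D)
    (he : ∀ x ∈ D, EquicontinuousAt f x) {b w : E} {U : Set E}
    (hU : Bornology.IsVonNBounded ℂ (⋃ i, f i '' (U ∩ D)))
    (hmem : ∀ t ∈ Metric.ball (0 : ℂ) 2, b + t • w ∈ U ∩ D)
    (hconv : ∀ᶠ t in 𝓝 (0 : ℂ), CauchySeq fun i => f i (b + t • w)) :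
    CauchySeq fun i => f i (b + w) := by
  have := FrechetSpace.polynormableSpace (F := F)
  obtain ⟨δ', hδ', hδc⟩ := Metric.eventually_nhds_iff_ball.1 hconv
  obtain ⟨δ, hδ, hδ2⟩ := exists_between (lt_min hδ' two_pos)
  obtain ⟨hδδ', hδ2⟩ := lt_min_iff.1 hδ2
  set K : Set E := (fun t : ℂ => b + t • w) '' Metric.closedBall 0 δ with hK
  have hKc : IsCompact K := (isCompact_closedBall _ _).image (by fun_prop)
  have hKconv : ∀ x ∈ K, ∃ y, Tendsto (fun i => f i x) atTop (𝓝 y) := by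
    rintro _ ⟨t, ht, rfl⟩
    exact cauchySeq_tendsto_of_complete (hδc t (Metric.closedBall_subset_ball hδδ' ht))
  choose! g hg using hKconv
  have hKD : K ⊆ D := by
    rintro _ ⟨t, ht, rfl⟩
    exact (hmem t (Metric.closedBall_subset_ball hδ2 ht)).2
  have hunif := (tendstoUniformlyOn_of_equicontinuousAt hKc (fun x hx => he x (hKD hx))
    hg).uniformCauchySeqOn
  rw [cauchySeq_iff]
  intro W hW
  obtain ⟨q, hq, hqW⟩ := exists_seminorm_sub_lt_one_imp hW
  obtain ⟨C, hC, hqC⟩ := hU.exists_seminorm_le hq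
  obtain ⟨η, hη, hmain⟩ := exists_norm_apply_one_le (C := 2 * C) (ε := 1 / 2) (by positivity)
    (by norm_num) hδ hδ2
  have hev : {p : F × F | q (p.2 - p.1) < η} ∈ uniformity F := by
    rw [uniformity_eq_comap_nhds_zero F]
    refine ⟨q.ball 0 η, ?_, fun p hp => by simpa using hp⟩
    exact q.ball_mem_nhds hq hη
  have hev' := hunif _ hev
  rw [prod_atTop_atTop_eq] at hev'
  obtain ⟨N, hN⟩ := eventually_atTop_prod_self'.1 hev'
  refine ⟨N, fun i hi j hj => hqW _ _ ?_⟩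
  have hbd : ∀ i, ∀ y ∈ U ∩ D, q (f i y) ≤ C := fun i y hy =>
    hqC _ (Set.mem_iUnion.2 ⟨i, Set.mem_image_of_mem _ hy⟩)
  -- `φ` varies with `i` and `j`, but `η` was fixed from `C` and `δ` alone.
  obtain ⟨φ, hφ, hφq⟩ := q.exists_dual_apply_eq hq (f j (b + w) - f i (b + w))
  have hbD : b ∈ D := by simpa using (hmem 0 (by simp)).2
  have hsub : Metric.ball (0 : ℂ) 2 ⊆ {t | b + t • w ∈ D} := fun t ht => (hmem t ht).2
  have hlast := hmain (fun t => φ (f j (b + t • w)) - φ (f i (b + t • w)))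
    ((((hf j).2 b hbD w φ).mono hsub).sub (((hf i).2 b hbD w φ).mono hsub))
    (fun t ht => by
      rw [← map_sub]
      refine (hφq _).trans ((map_sub_le_add q _ _).trans ?_)
      linarith [hbd i _ (hmem t ht), hbd j _ (hmem t ht)])
    (fun t ht => by
      rw [← map_sub]
      exact (hφq _).trans (hN i hi j hj _ (Set.mem_image_of_mem _ ht)).le)
  simp only [one_smul, ← map_sub, hφ] at hlast
  linarith

/-- If a locally bounded sequence of holomorphic maps on a domain converges at every point of a
non-empty open subset, it converges at every point. -/
theorem LocallyBoundedSeqOn.cauchySeq_of_cauchySeq_on_open [FrechetSpace F]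
    [FrechetSpace E] {D : Set E} (hDo : IsOpen D) (hDc : IsConnected D) {f : ℕ → E → F}
    (hf : ∀ i, HolomorphicOn (f i) D)
    (hb : LocallyBoundedSeqOn f D) {u : Set E} (hu : IsOpen u) (hne : (D ∩ u).Nonempty)
    (hconv : ∀ z ∈ D ∩ u, CauchySeq fun i => f i z) :
    ∀ z ∈ D, CauchySeq fun i => f i z := by
  have he : ∀ x ∈ D, EquicontinuousAt f x := fun x hx => hb.equicontinuousAt hDo hf hx
  set S : Set E := interior {z | z ∈ D ∧ CauchySeq fun i => f i z} with hS
  suffices hDS : D ⊆ S from fun z hz => (interior_subset (hDS hz)).2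
  refine hDc.isPreconnected.subset_of_closure_inter_subset isOpen_interior ?_ ?_
  · obtain ⟨z, hzD, hzu⟩ := hne
    exact ⟨z, hzD, mem_interior_iff_mem_nhds.2 <|
      mem_of_superset ((hDo.inter hu).mem_nhds ⟨hzD, hzu⟩) fun y hy => ⟨hy.1, hconv y hy⟩⟩
  rintro a ⟨haS, haD⟩
  obtain ⟨U, hU, hUb⟩ := hb a haD
  obtain ⟨V, hV, hVb, hVU⟩ := exists_balanced_add_mem (inter_mem hU (hDo.mem_nhds haD))
  have h1 : ∀ᶠ b in 𝓝 a, b - a ∈ V :=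
    (Continuous.tendsto' (f := fun b : E => b - a) (by fun_prop) a 0 (by simp)) hV
  -- The factor 2 lets balancedness of `V` keep the disc of radius 2 on the line through `b` and `z`
  -- inside `U ∩ D`, with `z` at parameter 1.
  have h2 : ∀ᶠ b in 𝓝 a, (2 : ℂ) • (a - b) ∈ interior V :=
    (Continuous.tendsto' (f := fun b : E => (2 : ℂ) • (a - b)) (by fun_prop) a 0 (by simp))
      (interior_mem_nhds.2 hV)
  obtain ⟨b, ⟨hb1, hb2⟩, hbS⟩ := mem_closure_iff_nhds.1 haS _ (h1.and h2)
  have h3 : ∀ᶠ z in 𝓝 a, (2 : ℂ) • (z - b) ∈ interior V :=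
    (Continuous.tendsto (f := fun z : E => (2 : ℂ) • (z - b)) (by fun_prop) a)
      (isOpen_interior.mem_nhds hb2)
  rw [hS, mem_interior_iff_mem_nhds]
  filter_upwards [h3, hDo.mem_nhds haD] with z hz hzD
  refine ⟨hzD, ?_⟩
  have hmem : ∀ t ∈ Metric.ball (0 : ℂ) 2, b + t • (z - b) ∈ U ∩ D := fun t ht => by
    have ht' : ‖t / 2‖ ≤ 1 := by
      rw [norm_div, Complex.norm_ofNat, div_le_one two_pos]
      exact (mem_ball_zero_iff.1 ht).le
    have := hVU _ hb1 _ (hVb.smul_mem ht' (interior_subset hz))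
    rwa [smul_smul, div_mul_cancel₀ _ two_ne_zero, add_sub_cancel] at this
  have hline : Tendsto (fun t : ℂ => b + t • (z - b)) (𝓝 0) (𝓝 b) :=
    Continuous.tendsto' (by fun_prop) _ _ (by simp)
  have := cauchySeq_apply_add_of_line hf he hUb hmem
    (mem_of_superset (hline (mem_interior_iff_mem_nhds.1 hbS)) fun t ht => ht.2)
  rwa [add_sub_cancel] at this

theorem CauchySeq.of_mem_closure {X α : Type*} [TopologicalSpace X] [UniformSpace α]
    {f : ℕ → X → α} {a : X} (he : EquicontinuousAt f a) {s : Set X} (ha : a ∈ closure s)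
    (hs : ∀ z ∈ s, CauchySeq fun i => f i z) : CauchySeq fun i => f i a := by
  rw [cauchySeq_iff]
  intro W hW
  obtain ⟨V, hV, hVs, hVW⟩ := comp_comp_symm_mem_uniformity_sets hW
  obtain ⟨z, hz, hzs⟩ := mem_closure_iff_nhds.1 ha _ (he V hV)
  obtain ⟨N, hN⟩ := cauchySeq_iff.1 (hs z hzs) V hV
  exact ⟨N, fun k hk l hl => hVW ⟨_, ⟨_, hz k, hN k hk l hl⟩, hVs.symm _ _ (hz l)⟩⟩

/-- Weierstrass' theorem on each line: compact sets of parameters have compact images in `D`, where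
convergence is uniform. -/
theorem HolomorphicOn.of_tendsto [FrechetSpace F] [FrechetSpace E] {D : Set E} (hDo : IsOpen D)
    {f : ℕ → E → F} {g : E → F} (hf : ∀ i, HolomorphicOn (f i) D)
    (he : ∀ x ∈ D, EquicontinuousAt f x)
    (hg : ∀ x ∈ D, Tendsto (fun i => f i x) atTop (𝓝 (g x))) : HolomorphicOn g D := by
  refine ⟨Tendsto.continuousOn_of_equicontinuousOn hg
    fun x hx => (he x hx).equicontinuousWithinAt D, fun a ha b φ => ?_⟩
  have hc : Continuous fun t : ℂ => a + t • b := by fun_prop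
  have ho : IsOpen {t : ℂ | a + t • b ∈ D} := hDo.preimage hc
  refine TendstoLocallyUniformlyOn.differentiableOn
    (F := fun i t => φ (f i (a + t • b))) (φ := atTop) ?_ (.of_forall fun i => (hf i).2 a ha b φ) ho
  rw [tendstoLocallyUniformlyOn_iff_forall_isCompact ho]
  intro K hKD hK
  have hu := tendstoUniformlyOn_of_equicontinuousAt (hK.image hc)
    (fun x hx => he x (by obtain ⟨t, ht, rfl⟩ := hx; exact hKD ht))
    (fun x hx => hg x (by obtain ⟨t, ht, rfl⟩ := hx; exact hKD ht))
  exact φ.uniformContinuous.comp_tendstoUniformlyOn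
    ((hu.comp fun t : ℂ => a + t • b).mono (Set.subset_preimage_image _ _))

end

theorem mainTheorem6 {E F : Type*}
    [AddCommGroup E] [Module ℂ E] [UniformSpace E] [FrechetSpace E]
    [AddCommGroup F] [Module ℂ F] [UniformSpace F] [FrechetSpace F]
    (D : Set E) (hDo : IsOpen D) (hDc : IsConnected D)
    (f : ℕ → E → F) (hf : ∀ i, HolomorphicOn (f i) D) (hb : LocallyBoundedSeqOn f D) :
    (∃ g : E → F, HolomorphicOn g D ∧
        ∀ K : Set E, K ⊆ D → IsCompact K → TendstoUniformlyOn f g atTop K) ↔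
      ¬ IsNowhereDense {z : D | ∃ w : F, Tendsto (fun i => f i z) atTop (𝓝 w)} := by
  constructor
  · rintro ⟨g, -, hg⟩ hnd
    have huniv : {z : D | ∃ w : F, Tendsto (fun i => f i z) atTop (𝓝 w)} = Set.univ :=
      Set.eq_univ_of_forall fun z => ⟨g z,
        (hg {z.1} (Set.singleton_subset_iff.2 z.2) isCompact_singleton).tendsto_at rfl⟩
    rw [huniv, IsNowhereDense, closure_univ, interior_univ] at hnd
    obtain ⟨z, hz⟩ := hDc.nonempty
    exact (hnd ▸ Set.mem_univ (⟨z, hz⟩ : D) : (⟨z, hz⟩ : D) ∈ (∅ : Set D)).elim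
  · intro hnd
    have he : ∀ x ∈ D, EquicontinuousAt f x := fun x hx => hb.equicontinuousAt hDo hf hx
    obtain ⟨z, hz⟩ := Set.nonempty_iff_ne_empty.2 hnd
    obtain ⟨u, hu, hue⟩ := isOpen_induced_iff.1 (isOpen_interior
      (s := closure {z : D | ∃ w : F, Tendsto (fun i => f i z) atTop (𝓝 w)}))
    have hconv : ∀ z ∈ D ∩ u, CauchySeq fun i => f i z := by
      rintro y ⟨hyD, hyu⟩
      have hy : (⟨y, hyD⟩ : D) ∈ Subtype.val ⁻¹' u := hyu
      rw [hue] at hy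
      refine CauchySeq.of_mem_closure (he y hyD)
        (image_closure_subset_closure_image continuous_subtype_val
          (Set.mem_image_of_mem _ (interior_subset hy))) ?_
      rintro _ ⟨x, ⟨w, hw⟩, rfl⟩
      exact hw.cauchySeq
    rw [← hue] at hz
    have hall : ∀ x ∈ D, ∃ y, Tendsto (fun i => f i x) atTop (𝓝 y) := fun x hx =>
      cauchySeq_tendsto_of_complete
        (hb.cauchySeq_of_cauchySeq_on_open hDo hDc hf hu ⟨z.1, z.2, hz⟩ hconv x hx)
    choose! g hg using hall
    exact ⟨g, .of_tendsto hDo hf he hg, fun K hKD hK =>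
      tendstoUniformlyOn_of_equicontinuousAt hK (fun x hx => he x (hKD hx))
        fun x hx => hg x (hKD hx)⟩
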